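/- Let $X$ and $Y$ be smooth manifolds of dimensions $n$ and $m$ (Hausdorff, second countable, without boundary), let $\pi : X \to Y$ be a smooth surjective submersion, and let $v$ be a smooth vector field on $X$. The system $\dot x = v(x)$ is called exactly lumpable for $\pi$ if there is a smooth vector field $\tilde v$ on $Y$ such that, for every integral curve $\gamma$ of $v$ defined on an open interval, $\pi\circ\gamma$ is an integral curve of $\tilde v$ (equivalently, $D\pi_x v(x) = \tilde v(\pi(x))$ for all $x \in X$, i.e. $v$ and $\tilde v$ are $\pi$-related). Let $\Gamma^\infty(X,\ker D\pi)$ be the space of smooth vector fields $w$ on $X$ with $D\pi_x w(x) = 0$ for all $x\in X$, and let $\mathcal L_v w = [v,w]$ be the Lie derivative. Then: (1) If $v$ is exactly lumpable for $\pi$, then $\mathcal L_v$ maps $\Gamma^\infty(X,\ker D\pi)$ into itself. (2) If all fibres $\pi^{-1}(y)$, $y \in Y$, are connected, then $v$ is exactly lumpable for $\pi$ if and only if $\mathcal L_v$ maps $\Gamma^\infty(X,\ker D\pi)$ into itself. -/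

import Mathlib

open scoped Manifold ContDiff

/-- `v` is a smooth vector field on the `n`-dimensional smooth manifold `M`, i.e. a smooth section
of the tangent bundle `TM → M`. -/
def IsSmoothVectorField {n : ℕ} {M : Type*} [TopologicalSpace M]
    [ChartedSpace (EuclideanSpace ℝ (Fin n)) M] [IsManifold (𝓡 n) ∞ M]
    (v : (x : M) → TangentSpace (𝓡 n) x) : Prop :=
  ContMDiff (𝓡 n) (𝓡 n).tangent ∞ (fun x => (⟨x, v x⟩ : TangentBundle (𝓡 n) M))

/-- `π : X → Y` is a smooth surjective submersion: it is smooth and onto, and its differential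
`Dπ_x : T_x X → T_{π(x)} Y` is onto at every point `x`. -/
structure IsSmoothSurjectiveSubmersion {n m : ℕ} {X Y : Type*}
    [TopologicalSpace X] [ChartedSpace (EuclideanSpace ℝ (Fin n)) X]
    [TopologicalSpace Y] [ChartedSpace (EuclideanSpace ℝ (Fin m)) Y]
    (π : X → Y) : Prop where
  smooth : ContMDiff (𝓡 n) (𝓡 m) ∞ π
  surjective : Function.Surjective π
  submersive : ∀ x : X, Function.Surjective (mfderiv (𝓡 n) (𝓡 m) π x)

/-- The system `dΦ/dt = v ∘ Φ` generated by the vector field `v` on `X` is exactly (smoothly)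
lumpable for `π : X → Y`: there is a smooth vector field `v'` on `Y` which governs the dynamics of
`Θ = π ∘ Φ`, i.e. for every integral curve `γ` of `v`, defined on an open interval `J` of times,
the curve `π ∘ γ` is an integral curve of `v'` on `J`. -/
def ExactlyLumpable {n m : ℕ} {X Y : Type*}
    [TopologicalSpace X] [ChartedSpace (EuclideanSpace ℝ (Fin n)) X]
    [TopologicalSpace Y] [ChartedSpace (EuclideanSpace ℝ (Fin m)) Y] [IsManifold (𝓡 m) ∞ Y]
    (v : (x : X) → TangentSpace (𝓡 n) x) (π : X → Y) : Prop :=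
  ∃ v' : (y : Y) → TangentSpace (𝓡 m) y, IsSmoothVectorField v' ∧
    ∀ (γ : ℝ → X) (J : Set ℝ), IsOpen J → J.OrdConnected →
      IsMIntegralCurveOn (I := 𝓡 n) γ v J → IsMIntegralCurveOn (I := 𝓡 m) (π ∘ γ) v' J

/-- `w` belongs to the space `Γ^∞(X, ker Dπ)` of smooth sections of the vertical distribution
`ker Dπ ⊆ TX`. -/
def IsVerticalVectorField {n m : ℕ} {X Y : Type*}
    [TopologicalSpace X] [ChartedSpace (EuclideanSpace ℝ (Fin n)) X] [IsManifold (𝓡 n) ∞ X]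
    [TopologicalSpace Y] [ChartedSpace (EuclideanSpace ℝ (Fin m)) Y]
    (π : X → Y) (w : (x : X) → TangentSpace (𝓡 n) x) : Prop :=
  IsSmoothVectorField w ∧ ∀ x : X, mfderiv (𝓡 n) (𝓡 m) π x (w x) = 0

/-- The space `Γ^∞(X, ker Dπ)` is invariant under the Lie derivative `L_v = [v, ·]`. -/
def VerticalFieldsInvariant {n m : ℕ} {X Y : Type*}
    [TopologicalSpace X] [ChartedSpace (EuclideanSpace ℝ (Fin n)) X] [IsManifold (𝓡 n) ∞ X]
    [TopologicalSpace Y] [ChartedSpace (EuclideanSpace ℝ (Fin m)) Y]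
    (v : (x : X) → TangentSpace (𝓡 n) x) (π : X → Y) : Prop :=
  ∀ w : (x : X) → TangentSpace (𝓡 n) x, IsVerticalVectorField (m := m) π w →
    IsVerticalVectorField (m := m) π (VectorField.mlieBracket (𝓡 n) v w)

/-!
Exact lumpability means that `v` is `π`-related to a smooth vector field on `Y`
(`exactlyLumpable_iff_exists_related`), so the theorem compares this infinitesimal condition with
the invariance of the vertical fields.

Everything is read off in coordinates `X ⊇ U ≅ V ⊆ ℝᵐ × K` in which the submersion `π` is the
projection onto the first factor (`ContMDiff.exists_straightens`, from the implicit function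
theorem). Let `u` be the first component of `v` in these coordinates; it represents
`x ↦ Dπ_x (v x)`. A vertical field `w` has first component `0`, so the first component of
`[v, w] = Dw(v) - Dv(w)` is `-Du(w)` (`Straightens.mfderiv_mlieBracket`). Hence `[v, w]` is vertical
exactly where the derivative of `u` in the direction `w` vanishes.

If `v` is related to a field on `Y`, then `u` depends only on the first factor, its derivative in
vertical directions vanishes, and the bracket is vertical. Conversely, every vertical tangent vector
is the value of a global vertical field (`exists_isVerticalVectorField_eq`), so invariance forces
the vertical derivatives of `u` to vanish; thus `Dπ (v)` is locally constant on the fibres, and constant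
when they are connected (`VerticalFieldsInvariant.mfderiv_eq`). It then descends to a field on `Y`,
which is smooth because `π` has smooth local sections (`exists_contMDiffAt_section`).
-/

section

open Set Filter Topology

/-! ### Straightening a submersion -/

/-- Euclidean submersion theorem: a smooth map with surjective differential at `a` is the first
component of a smooth local diffeomorphism at `a`, obtained by adding a linear projection onto the
kernel of the differential. -/
theorem ContDiffOn.exists_openPartialHomeomorph_fst_eq {E F : Type*}
    [NormedAddCommGroup E] [NormedSpace ℝ E] [FiniteDimensional ℝ E]
    [NormedAddCommGroup F] [NormedSpace ℝ F] [FiniteDimensional ℝ F]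
    {f : E → F} {u : Set E} {a : E} (hu : IsOpen u) (ha : a ∈ u) (hf : ContDiffOn ℝ ∞ f u)
    (hsurj : Function.Surjective (fderiv ℝ f a)) :
    ∃ Φ : OpenPartialHomeomorph E (F × (fderiv ℝ f a).ker), a ∈ Φ.source ∧ Φ.source ⊆ u ∧
      ContDiffOn ℝ ∞ Φ Φ.source ∧ ContDiffOn ℝ ∞ Φ.symm Φ.target ∧ ∀ x, (Φ x).1 = f x := by
  have : CompleteSpace E := FiniteDimensional.complete ℝ E
  have : CompleteSpace F := FiniteDimensional.complete ℝ F
  have hfa : ContDiffAt ℝ ∞ f a := hf.contDiffAt (hu.mem_nhds ha)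
  have hstrict : HasStrictFDerivAt f (fderiv ℝ f a) a := hfa.hasStrictFDerivAt (by simp)
  have hrange : (fderiv ℝ f a).range = ⊤ := LinearMap.range_eq_top.2 hsurj
  have hker := (fderiv ℝ f a).ker_closedComplemented_of_finiteDimensional_range
  let D := HasStrictFDerivAt.implicitFunctionDataOfComplemented f (fderiv ℝ f a) hstrict hrange hker
  let Ψ := D.toOpenPartialHomeomorph
  have hΨa : a ∈ Ψ.source := D.pt_mem_toOpenPartialHomeomorph_source
  -- by construction `Ψ x = (f x, P (x - a))` for a continuous projection `P` onto the kernel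
  have hΨu : ContDiffOn ℝ ∞ Ψ u := by
    refine (hf.prodMk ?_ : ContDiffOn ℝ ∞ (fun x => (f x, Classical.choose hker (x - a))) u)
    exact ((Classical.choose hker).contDiff.comp (contDiff_id.sub contDiff_const)).contDiffOn
  -- the locus where the differential is invertible is open and contains `a`
  have hinv : ∀ᶠ x in 𝓝 a, fderiv ℝ Ψ x ∈
      range ((↑) : (E ≃L[ℝ] F × (fderiv ℝ f a).ker) → (E →L[ℝ] F × (fderiv ℝ f a).ker)) := by
    have hcont : ContinuousAt (fderiv ℝ Ψ) a :=
      (hΨu.contDiffAt (hu.mem_nhds ha)).continuousAt_fderiv (by simp)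
    apply hcont
    obtain ⟨e, he⟩ := D.isInvertible_fderiv_prodFun
    have : fderiv ℝ Ψ a = e := he.symm
    rw [this]
    exact ContinuousLinearEquiv.nhds e
  obtain ⟨s, hs, hso, has⟩ := eventually_nhds_iff.1 hinv
  refine ⟨Ψ.restrOpen (s ∩ u) (hso.inter hu), ?_, ?_, ?_, ?_, fun x => rfl⟩
  · simpa using ⟨hΨa, has, ha⟩
  · exact fun x hx => hx.2.2
  · exact hΨu.mono fun x hx => hx.2.2
  · intro p hp
    have hx := (Ψ.restrOpen (s ∩ u) (hso.inter hu)).map_target hp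
    obtain ⟨e, he⟩ := hs _ hx.2.1
    have hc : ContDiffAt ℝ ∞ Ψ (Ψ.symm p) := hΨu.contDiffAt (hu.mem_nhds hx.2.2)
    refine (Ψ.contDiffAt_symm (f₀' := e) hp.1 ?_ hc).contDiffWithinAt
    have := (hc.differentiableAt (by simp)).hasFDerivAt
    rwa [show fderiv ℝ Ψ (Ψ.symm p) = e from he.symm] at this

section

variable {n m : ℕ} {X Y : Type*}
  [TopologicalSpace X] [ChartedSpace (EuclideanSpace ℝ (Fin n)) X]
  [TopologicalSpace Y] [ChartedSpace (EuclideanSpace ℝ (Fin m)) Y]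

/-- `τ` is a local diffeomorphism from `X` to `ℝᵐ × K` which straightens `π`: it carries `π`, read
in the preferred chart of `Y` at `y₀`, to the projection onto the first factor. -/
def Straightens {K : Type*} [NormedAddCommGroup K] [NormedSpace ℝ K]
    (τ : PartialDiffeomorph (𝓡 n) 𝓘(ℝ, EuclideanSpace ℝ (Fin m) × K) X
        (EuclideanSpace ℝ (Fin m) × K) ∞) (π : X → Y) (y₀ : Y) : Prop :=
  ∀ x ∈ τ.source, π x ∈ (chartAt (EuclideanSpace ℝ (Fin m)) y₀).source ∧
        (τ x).1 = chartAt (EuclideanSpace ℝ (Fin m)) y₀ (π x)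

/-- The submersion theorem on manifolds: near a point where its differential is surjective, a smooth
map can be straightened to a projection. -/
theorem ContMDiff.exists_straightens [IsManifold (𝓡 n) ∞ X] [IsManifold (𝓡 m) ∞ Y] {π : X → Y}
    (hπ : ContMDiff (𝓡 n) (𝓡 m) ∞ π) (x₀ : X)
    (hsurj : Function.Surjective (mfderiv (𝓡 n) (𝓡 m) π x₀)) :
    ∃ (K : Submodule ℝ (EuclideanSpace ℝ (Fin n)))
      (τ : PartialDiffeomorph (𝓡 n) 𝓘(ℝ, EuclideanSpace ℝ (Fin m) × K) X
        (EuclideanSpace ℝ (Fin m) × K) ∞),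
      x₀ ∈ τ.source ∧ Straightens τ π (π x₀) := by
  set c := chartAt (EuclideanSpace ℝ (Fin n)) x₀
  set c' := chartAt (EuclideanSpace ℝ (Fin m)) (π x₀) with hc'
  have hx₀ : x₀ ∈ c.source := mem_chart_source _ x₀
  have hy₀ : π x₀ ∈ c'.source := mem_chart_source _ (π x₀)
  let u := c.target ∩ c.symm ⁻¹' (π ⁻¹' c'.source)
  have hu : IsOpen u :=
    c.isOpen_inter_preimage_symm (c'.open_source.preimage hπ.continuous)
  have hcc : ContMDiffOn (𝓡 n) (𝓡 n) ∞ c c.source := contMDiffOn_chart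
  have hcs : ContMDiffOn (𝓡 n) (𝓡 n) ∞ c.symm c.target := contMDiffOn_chart_symm
  have hcc' : ContMDiffOn (𝓡 m) (𝓡 m) ∞ c' c'.source := contMDiffOn_chart
  have hf : ContDiffOn ℝ ∞ (c' ∘ π ∘ c.symm) u := by
    rw [← contMDiffOn_iff_contDiffOn]
    exact hcc'.comp ((hπ.contMDiffOn (s := univ)).comp (hcs.mono inter_subset_left)
      (fun _ _ => mem_univ _)) fun x hx => hx.2
  have ha : c x₀ ∈ u := ⟨c.map_source hx₀, by simpa [c.left_inv hx₀] using hy₀⟩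
  have hd : Function.Surjective (fderiv ℝ (c' ∘ π ∘ c.symm) (c x₀)) := by
    rw [← mfderiv_eq_fderiv]
    have h1 : MDifferentiableAt (𝓡 n) (𝓡 n) c.symm (c x₀) :=
      mdifferentiableAt_atlas_symm (chart_mem_atlas _ x₀) (c.map_source hx₀)
    have h2 : MDifferentiableAt (𝓡 n) (𝓡 m) π (c.symm (c x₀)) :=
      (hπ _).mdifferentiableAt (by simp)
    have h3 : MDifferentiableAt (𝓡 m) (𝓡 m) c' ((π ∘ c.symm) (c x₀)) :=
      mdifferentiableAt_atlas (chart_mem_atlas _ _) (by simp [c.left_inv hx₀, mem_chart_source])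
    rw [mfderiv_comp _ h3 (h2.comp _ h1), mfderiv_comp _ h2 h1]
    have e1 := (mdifferentiable_chart (I := 𝓡 n) x₀).symm.mfderiv_surjective (c.map_source hx₀)
    have e3 := (mdifferentiable_chart (I := 𝓡 m) (π x₀)).mfderiv_surjective
      (x := (π ∘ c.symm) (c x₀)) (by simp [c.left_inv hx₀, mem_chart_source])
    have e2 : Function.Surjective (mfderiv (𝓡 n) (𝓡 m) π (c.symm (c x₀))) := by
      rw [c.left_inv hx₀]; exact hsurj
    exact e3.comp (e2.comp e1)
  obtain ⟨Φ, hΦa, hΦu, hΦ, hΦs, hΦf⟩ := hf.exists_openPartialHomeomorph_fst_eq hu ha hd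
  let T := c.trans Φ
  have hT : T.source = c.source ∩ c ⁻¹' Φ.source := by simp [T]
  have hT' : T.target = Φ.target ∩ Φ.symm ⁻¹' c.target := by simp [T]
  refine ⟨_, { T.toPartialEquiv with
    open_source := T.open_source
    open_target := T.open_target
    contMDiffOn_toFun := ?_
    contMDiffOn_invFun := ?_ }, ?_, ?_⟩
  · exact (contMDiffOn_iff_contDiffOn.2 hΦ).comp (hcc.mono fun x hx => (hT.subset hx).1)
      fun x hx => (hT.subset hx).2
  · exact hcs.comp ((contMDiffOn_iff_contDiffOn.2 hΦs).mono fun x hx => (hT'.subset hx).1)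
      fun x hx => (hT'.subset hx).2
  · exact hT.superset ⟨hx₀, hΦa⟩
  · intro x hx
    have hx' := hT.subset hx
    have h := hΦu hx'.2
    refine ⟨by simpa [u, c.left_inv hx'.1] using h.2, ?_⟩
    change (Φ (c x)).1 = _
    rw [hΦf]
    simp [c.left_inv hx'.1, ← hc']

end

/-! ### Partial diffeomorphisms and vector fields -/

section
variable {E : Type*} [NormedAddCommGroup E] [NormedSpace ℝ E] {H : Type*} [TopologicalSpace H]
  {I : ModelWithCorners ℝ E H} {M : Type*} [TopologicalSpace M] [ChartedSpace H M]
  {E' : Type*} [NormedAddCommGroup E'] [NormedSpace ℝ E'] {H' : Type*} [TopologicalSpace H']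
  {J : ModelWithCorners ℝ E' H'} {N : Type*} [TopologicalSpace N] [ChartedSpace H' N]

theorem PartialDiffeomorph.isInvertible_mfderiv (τ : PartialDiffeomorph I J M N ∞) {x : M}
    (hx : x ∈ τ.source) : (mfderiv I J τ x).IsInvertible :=
  ⟨(τ.isLocalDiffeomorphAt I J ∞ hx).mfderivToContinuousLinearEquiv (by simp), rfl⟩

theorem PartialDiffeomorph.contMDiffAt (τ : PartialDiffeomorph I J M N ∞) {x : M}
    (hx : x ∈ τ.source) : ContMDiffAt I J ∞ τ x :=
  τ.contMDiffOn.contMDiffAt (τ.open_source.mem_nhds hx)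

/-- Pulling a vector field back under the inverse of `τ` is pushing it forward by `τ`. -/
theorem PartialDiffeomorph.mpullback_symm_apply (τ : PartialDiffeomorph I J M N ∞)
    (v : (x : M) → TangentSpace I x) {x : M} (hx : x ∈ τ.source) :
    (VectorField.mpullback J I τ.symm v (τ x) : E') = mfderiv I J τ x (v x) := by
  have hp : τ x ∈ τ.target := τ.map_source hx
  have hσx : τ.symm (τ x) = x := τ.left_inv hx
  have hτ' : MDifferentiableAt I J τ (τ.symm (τ x)) := by
    rw [hσx]; exact τ.mdifferentiableAt (by simp) hx
  have hσ := τ.symm.mdifferentiableAt (by simp) (x := τ x) hp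
  have hcomp : (mfderiv J I τ.symm (τ x)).comp (mfderiv I J τ x) =
      ContinuousLinearMap.id ℝ (TangentSpace I x) := by
    rw [← mfderiv_id, ← mfderiv_comp x hσ (τ.mdifferentiableAt (by simp) hx)]
    refine Filter.EventuallyEq.mfderiv_eq ?_
    filter_upwards [τ.open_source.mem_nhds hx] with z hz using τ.left_inv hz
  obtain ⟨e, he⟩ := τ.symm.isInvertible_mfderiv (x := τ x) hp
  rw [VectorField.mpullback_apply, ← he, ContinuousLinearMap.inverse_equiv]
  apply e.injective
  have h1 := DFunLike.congr_fun hcomp (v x)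
  rw [← he] at h1
  refine Eq.trans (e.apply_symm_apply _) ?_
  refine Eq.trans ?_ h1.symm
  change v (τ.symm (τ x)) = (v x : E)
  rw [hσx]

end

theorem VectorField.mlieBracket_eq_lieBracket {E : Type*} [NormedAddCommGroup E] [NormedSpace ℝ E]
    (U W : (x : E) → TangentSpace 𝓘(ℝ, E) x) :
    VectorField.mlieBracket 𝓘(ℝ, E) U W = VectorField.lieBracket ℝ (U : E → E) (W : E → E) := by
  rw [← VectorField.mlieBracketWithin_univ, VectorField.mlieBracketWithin_eq_lieBracketWithin]
  exact VectorField.lieBracketWithin_univ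

/-- If `W` is tangent to the second factor, the term `DW(U)` of `[U, W] = DW(U) - DU(W)` has no
component along the first factor. -/
theorem VectorField.fst_lieBracket_of_fst_eq_zero {F K : Type*}
    [NormedAddCommGroup F] [NormedSpace ℝ F] [NormedAddCommGroup K] [NormedSpace ℝ K]
    {U W : F × K → F × K} {p : F × K} (hU : DifferentiableAt ℝ U p) (hW : DifferentiableAt ℝ W p)
    (hW₀ : ∀ᶠ q in 𝓝 p, (W q).1 = 0) :
    (VectorField.lieBracket ℝ U W p).1 = -fderiv ℝ (fun q => (U q).1) p (W p) := by
  have h1 : fderiv ℝ (fun q => (W q).1) p = 0 := by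
    rw [Filter.EventuallyEq.fderiv_eq (f := fun _ => (0 : F)) hW₀]
    simp
  rw [fderiv.fst hW] at h1
  rw [fderiv.fst hU, VectorField.lieBracket]
  have := DFunLike.congr_fun h1 (U p)
  simp at this ⊢
  exact this

/-! ### Vector fields in straightened coordinates -/

section

variable {n m : ℕ} {X Y : Type*}
  [TopologicalSpace X] [ChartedSpace (EuclideanSpace ℝ (Fin n)) X]
  [TopologicalSpace Y] [ChartedSpace (EuclideanSpace ℝ (Fin m)) Y]
  {K : Type*} [NormedAddCommGroup K] [NormedSpace ℝ K]
  {π : X → Y} {y₀ : Y}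
  {τ : PartialDiffeomorph (𝓡 n) 𝓘(ℝ, EuclideanSpace ℝ (Fin m) × K) X
        (EuclideanSpace ℝ (Fin m) × K) ∞}

theorem Straightens.fst_mfderiv [IsManifold (𝓡 m) ∞ Y] (hτ : Straightens τ π y₀)
    (hπ : ContMDiff (𝓡 n) (𝓡 m) ∞ π)
    {x : X} (hx : x ∈ τ.source) (a : TangentSpace (𝓡 n) x) :
    (mfderiv (𝓡 n) 𝓘(ℝ, EuclideanSpace ℝ (Fin m) × K) τ x a : EuclideanSpace ℝ (Fin m) × K).1 =
      mfderiv (𝓡 m) (𝓡 m) (chartAt (EuclideanSpace ℝ (Fin m)) y₀) (π x)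
        (mfderiv (𝓡 n) (𝓡 m) π x a) := by
  have h1 : mfderiv (𝓡 n) (𝓡 m) (fun z => (τ z).1) x =
      mfderiv (𝓡 n) (𝓡 m) (chartAt (EuclideanSpace ℝ (Fin m)) y₀ ∘ π) x := by
    refine Filter.EventuallyEq.mfderiv_eq ?_
    filter_upwards [τ.open_source.mem_nhds hx] with z hz using (hτ z hz).2
  rw [mfderiv_comp x (mdifferentiableAt_atlas (chart_mem_atlas _ y₀) (hτ x hx).1)
    ((hπ x).mdifferentiableAt (by simp))] at h1
  have h2 := mfderiv_comp x (I := 𝓡 n) (I'' := 𝓡 m)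
    (ContinuousLinearMap.fst ℝ (EuclideanSpace ℝ (Fin m)) K).differentiableAt.mdifferentiableAt
    (τ.mdifferentiableAt (by simp) hx)
  rw [mfderiv_eq_fderiv, ContinuousLinearMap.fderiv] at h2
  exact DFunLike.congr_fun (h2.symm.trans h1) a

/-- The first component of `v` in straightened coordinates is `Dπ (v)` read in the chart of `Y`; both are
called the horizontal component of `v`. -/
theorem Straightens.fst_mpullback_symm [IsManifold (𝓡 m) ∞ Y] (hτ : Straightens τ π y₀)
    (hπ : ContMDiff (𝓡 n) (𝓡 m) ∞ π) (v : (x : X) → TangentSpace (𝓡 n) x)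
    {x : X} (hx : x ∈ τ.source) :
    (VectorField.mpullback 𝓘(ℝ, EuclideanSpace ℝ (Fin m) × K) (𝓡 n) τ.symm v (τ x) :
      EuclideanSpace ℝ (Fin m) × K).1 =
      mfderiv (𝓡 m) (𝓡 m) (chartAt (EuclideanSpace ℝ (Fin m)) y₀) (π x)
        (mfderiv (𝓡 n) (𝓡 m) π x (v x)) := by
  rw [← hτ.fst_mfderiv hπ hx, ← τ.mpullback_symm_apply v hx]

theorem mfderiv_chartAt_injective [IsManifold (𝓡 m) ∞ Y] {y : Y}
    (hy : y ∈ (chartAt (EuclideanSpace ℝ (Fin m)) y₀).source) :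
    Function.Injective (mfderiv (𝓡 m) (𝓡 m) (chartAt (EuclideanSpace ℝ (Fin m)) y₀) y) :=
  (mdifferentiable_chart (I := 𝓡 m) y₀).mfderiv_injective hy

theorem contDiffAt_mpullback_symm [IsManifold (𝓡 n) ∞ X] [CompleteSpace K]
    {v : (x : X) → TangentSpace (𝓡 n) x}
    (hv : IsSmoothVectorField v) {x : X} (hx : x ∈ τ.source) :
    ContDiffAt ℝ ∞ (VectorField.mpullback 𝓘(ℝ, EuclideanSpace ℝ (Fin m) × K) (𝓡 n) τ.symm v)
      (τ x) := by
  rw [← contMDiffAt_vectorSpace_iff_contDiffAt]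
  have hp : τ x ∈ τ.target := τ.map_source hx
  exact ContMDiffAt.mpullback_vectorField_preimage (n := ∞) (hv _) (τ.symm.contMDiffAt hp)
    (τ.symm.isInvertible_mfderiv hp) (by simp)

/-- The identity behind both implications. With `u` the horizontal component of `v` in straightened
coordinates, the horizontal component of `[v, w]`, for a vertical `w`, is `-Du(w)`. -/
theorem Straightens.mfderiv_mlieBracket [IsManifold (𝓡 n) ∞ X] [IsManifold (𝓡 m) ∞ Y]
    [CompleteSpace K] (hτ : Straightens τ π y₀)
    (hπ : ContMDiff (𝓡 n) (𝓡 m) ∞ π)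
    {v w : (x : X) → TangentSpace (𝓡 n) x} (hv : IsSmoothVectorField v)
    (hw : IsVerticalVectorField (m := m) π w) {x : X} (hx : x ∈ τ.source) :
    mfderiv (𝓡 m) (𝓡 m) (chartAt (EuclideanSpace ℝ (Fin m)) y₀) (π x)
        (mfderiv (𝓡 n) (𝓡 m) π x (VectorField.mlieBracket (𝓡 n) v w x)) =
    -fderiv ℝ (fun q => (VectorField.mpullback 𝓘(ℝ, EuclideanSpace ℝ (Fin m) × K) (𝓡 n)
      τ.symm v q : EuclideanSpace ℝ (Fin m) × K).1) (τ x)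
      (mfderiv (𝓡 n) 𝓘(ℝ, EuclideanSpace ℝ (Fin m) × K) τ x (w x)) := by
  have hp : τ x ∈ τ.target := τ.map_source hx
  have : IsManifold (𝓡 n) (minSmoothness ℝ 2) X := .of_le (n := ∞) (by simpa using ENat.LEInfty.out)
  have : IsManifold (𝓡 n) (minSmoothness ℝ 3) X := .of_le (n := ∞) (by simpa using ENat.LEInfty.out)
  rw [← hτ.fst_mfderiv hπ hx, ← τ.mpullback_symm_apply _ hx, ← τ.mpullback_symm_apply _ hx,
    VectorField.mpullback_mlieBracket (n := ∞) ((hv _).mdifferentiableAt (by simp))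
      ((hw.1 _).mdifferentiableAt (by simp)) (τ.symm.contMDiffAt hp)
      (by simpa using ENat.LEInfty.out), VectorField.mlieBracket_eq_lieBracket]
  refine VectorField.fst_lieBracket_of_fst_eq_zero (F := EuclideanSpace ℝ (Fin m)) (K := K)
    ((contDiffAt_mpullback_symm hv hx).differentiableAt (by simp))
    ((contDiffAt_mpullback_symm hw.1 hx).differentiableAt (by simp)) ?_
  filter_upwards [τ.open_target.mem_nhds hp] with q hq
  obtain ⟨z, hz, rfl⟩ : ∃ z ∈ τ.source, τ z = q := ⟨_, τ.map_target hq, τ.right_inv hq⟩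
  rw [hτ.fst_mpullback_symm hπ w hz, hw.2, map_zero]
  rfl

end

/-! ### Invariance makes the projected field constant on fibres -/

section

variable {n m : ℕ} {X Y : Type*}
  [TopologicalSpace X] [ChartedSpace (EuclideanSpace ℝ (Fin n)) X] [IsManifold (𝓡 n) ∞ X]
  [TopologicalSpace Y] [ChartedSpace (EuclideanSpace ℝ (Fin m)) Y] [IsManifold (𝓡 m) ∞ Y]
  {π : X → Y} {v : (x : X) → TangentSpace (𝓡 n) x}

/-- Every vertical tangent vector extends to a global vertical vector field: take the constant field
in straightened coordinates and cut it off. -/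
theorem exists_isVerticalVectorField_eq [T2Space X] (hπ : ContMDiff (𝓡 n) (𝓡 m) ∞ π) (x : X)
    (hsurj : Function.Surjective (mfderiv (𝓡 n) (𝓡 m) π x)) (a : TangentSpace (𝓡 n) x)
    (ha : mfderiv (𝓡 n) (𝓡 m) π x a = 0) :
    ∃ w : (x : X) → TangentSpace (𝓡 n) x, IsVerticalVectorField (m := m) π w ∧ w x = a := by
  obtain ⟨K, τ, hx, hτ⟩ := hπ.exists_straightens x hsurj
  have hax := hτ.fst_mfderiv hπ hx a
  rw [ha, map_zero] at hax
  set b : EuclideanSpace ℝ (Fin m) × K :=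
    mfderiv (𝓡 n) 𝓘(ℝ, EuclideanSpace ℝ (Fin m) × K) τ x a with hb
  let W : (x : X) → TangentSpace (𝓡 n) x :=
    VectorField.mpullback (𝓡 n) 𝓘(ℝ, EuclideanSpace ℝ (Fin m) × K) τ (fun _ => b)
  have hW : ContMDiffOn (𝓡 n) (𝓡 n).tangent ∞
      (fun x => (⟨x, W x⟩ : TangentBundle (𝓡 n) X)) τ.source := by
    intro z hz
    refine (ContMDiffAt.mpullback_vectorField_preimage (n := ∞) ?_ (τ.contMDiffAt hz)
      (τ.isInvertible_mfderiv hz) (by simp)).contMDiffWithinAt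
    exact contMDiffAt_vectorSpace_iff_contDiffAt.2 contDiffAt_const
  have hWb : ∀ z ∈ τ.source, mfderiv (𝓡 n) 𝓘(ℝ, EuclideanSpace ℝ (Fin m) × K) τ z (W z) = b := by
    intro z hz
    exact (τ.isInvertible_mfderiv hz).self_apply_inverse b
  obtain ⟨χ, -, hχ⟩ :=
    (SmoothBumpFunction.nhds_basis_tsupport (I := 𝓡 n) x).mem_iff.1 (τ.open_source.mem_nhds hx)
  refine ⟨(χ : X → ℝ) • W, ⟨χ.contMDiff.contMDiffOn.smul_section_of_tsupport τ.open_source hχ hW,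
    fun z => ?_⟩, ?_⟩
  · change mfderiv (𝓡 n) (𝓡 m) π z (χ z • W z) = 0
    rw [map_smul]
    by_cases hz : z ∈ τ.source
    · have h := hτ.fst_mfderiv hπ hz (W z)
      rw [hWb z hz, hax] at h
      rw [mfderiv_chartAt_injective (hτ z hz).1 (h.symm.trans (map_zero _).symm), smul_zero]
    · rw [image_eq_zero_of_notMem_tsupport fun h => hz (hχ h), zero_smul]
  · change χ x • W x = a
    rw [χ.eq_one, one_smul]
    obtain ⟨e, he⟩ := τ.isInvertible_mfderiv hx
    have h := hWb x hx
    rw [hb, ← he] at h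
    exact e.injective h

variable {K : Type*} [NormedAddCommGroup K] [NormedSpace ℝ K] [CompleteSpace K] {y₀ : Y}
  {τ : PartialDiffeomorph (𝓡 n) 𝓘(ℝ, EuclideanSpace ℝ (Fin m) × K) X
        (EuclideanSpace ℝ (Fin m) × K) ∞}

/-- If `L_v` preserves the vertical fields, then the horizontal component of `v` in straightened
coordinates has zero derivative along the fibres. -/
theorem VerticalFieldsInvariant.fderiv_fst_mpullback_eq_zero [T2Space X]
    (h : VerticalFieldsInvariant (m := m) v π) (hπ : ContMDiff (𝓡 n) (𝓡 m) ∞ π)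
    (hsurj : ∀ x, Function.Surjective (mfderiv (𝓡 n) (𝓡 m) π x))
    (hv : IsSmoothVectorField v) (hτ : Straightens τ π y₀)
    {p : EuclideanSpace ℝ (Fin m) × K} (hp : p ∈ τ.target) (c : K) :
    fderiv ℝ (fun q => (VectorField.mpullback 𝓘(ℝ, EuclideanSpace ℝ (Fin m) × K) (𝓡 n)
      τ.symm v q : EuclideanSpace ℝ (Fin m) × K).1) p (0, c) = 0 := by
  obtain ⟨x, hx, rfl⟩ : ∃ x ∈ τ.source, τ x = p := ⟨_, τ.map_target hp, τ.right_inv hp⟩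
  obtain ⟨e, he⟩ := τ.isInvertible_mfderiv hx
  have hea : mfderiv (𝓡 n) 𝓘(ℝ, EuclideanSpace ℝ (Fin m) × K) τ x (e.symm (0, c)) =
      ((0, c) : EuclideanSpace ℝ (Fin m) × K) := by
    rw [← he]; exact e.apply_symm_apply _
  have h1 := hτ.fst_mfderiv hπ hx (e.symm (0, c))
  rw [hea] at h1
  obtain ⟨w, hw, hwx⟩ := exists_isVerticalVectorField_eq hπ x (hsurj x) (e.symm (0, c))
    (mfderiv_chartAt_injective (hτ x hx).1 (h1.symm.trans (map_zero _).symm))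
  have h2 := hτ.mfderiv_mlieBracket hπ hv hw hx
  rw [hwx, hea, (h w hw).2, map_zero] at h2
  exact neg_eq_zero.1 h2.symm

/-- If the horizontal component of `v` has zero derivative along the fibres, then `x ↦ Dπ_x (v x)`
is locally constant on each fibre. The type ascription uses that all tangent spaces of `Y` are, by
definition, the model space. -/
theorem Straightens.eventually_mfderiv_eq
    (hπ : ContMDiff (𝓡 n) (𝓡 m) ∞ π) (hv : IsSmoothVectorField v) (hτ : Straightens τ π y₀)
    (h : ∀ p ∈ τ.target, ∀ c : K,
      fderiv ℝ (fun q => (VectorField.mpullback 𝓘(ℝ, EuclideanSpace ℝ (Fin m) × K) (𝓡 n)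
        τ.symm v q : EuclideanSpace ℝ (Fin m) × K).1) p (0, c) = 0) {x₀ : X} (hx₀ : x₀ ∈ τ.source) :
    ∀ᶠ x in 𝓝 x₀, π x = π x₀ →
      (mfderiv (𝓡 n) (𝓡 m) π x (v x) : EuclideanSpace ℝ (Fin m)) =
        mfderiv (𝓡 n) (𝓡 m) π x₀ (v x₀) := by
  set u : EuclideanSpace ℝ (Fin m) × K → EuclideanSpace ℝ (Fin m) := fun q =>
    (VectorField.mpullback 𝓘(ℝ, EuclideanSpace ℝ (Fin m) × K) (𝓡 n) τ.symm v q :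
      EuclideanSpace ℝ (Fin m) × K).1 with hu
  have hud : ∀ q ∈ τ.target, DifferentiableAt ℝ u q := by
    intro q hq
    have := contDiffAt_mpullback_symm (τ := τ) hv (τ.map_target hq)
    rw [show τ (τ.toPartialEquiv.symm q) = q from τ.right_inv hq] at this
    exact (this.differentiableAt (by simp)).fst
  obtain ⟨r, hr, hball⟩ := Metric.isOpen_iff.1 τ.open_target _ (τ.map_source hx₀)
  filter_upwards [τ.open_source.mem_nhds hx₀,
    (τ.contMDiffAt hx₀).continuousAt.preimage_mem_nhds (Metric.ball_mem_nhds _ hr)]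
    with x hx hxr hπx
  have h1 : (τ x).1 = (τ x₀).1 := by rw [(hτ x hx).2, (hτ x₀ hx₀).2, hπx]
  have hline : ∀ k ∈ Metric.ball (τ x₀).2 r, ((τ x₀).1, k) ∈ τ.target := by
    intro k hk
    refine hball ?_
    rw [Metric.mem_ball, Prod.dist_eq]
    simpa [hr] using hk
  have hder : ∀ k ∈ Metric.ball (τ x₀).2 r, HasFDerivAt (fun k => u ((τ x₀).1, k))
      (0 : K →L[ℝ] EuclideanSpace ℝ (Fin m)) k := by
    intro k hk
    have := (hud _ (hline k hk)).hasFDerivAt.comp k (hasFDerivAt_prodMk_right (τ x₀).1 k)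
    rwa [show (fderiv ℝ u ((τ x₀).1, k)).comp
      (ContinuousLinearMap.inr ℝ (EuclideanSpace ℝ (Fin m)) K) = 0 from
        ContinuousLinearMap.ext fun c => h _ (hline k hk) c] at this
  -- balls of the product are products of balls, so `τ x`, `τ x₀` lie on one convex vertical slice
  have hconst : u (τ x) = u (τ x₀) := by
    have := Metric.isOpen_ball.is_const_of_fderiv_eq_zero (convex_ball (τ x₀).2 r).isPreconnected
      (fun k hk => (hder k hk).differentiableAt.differentiableWithinAt)
      (fun k hk => (hder k hk).fderiv) (x := (τ x).2) (y := (τ x₀).2)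
      (by
        have := Metric.mem_ball.1 hxr
        rw [Prod.dist_eq] at this
        exact (le_max_right _ _).trans_lt this) (Metric.mem_ball_self hr)
    rwa [← h1, Prod.mk.eta, h1, Prod.mk.eta] at this
  rw [hu] at hconst
  dsimp only at hconst
  rw [hτ.fst_mpullback_symm hπ v hx, hτ.fst_mpullback_symm hπ v hx₀] at hconst
  -- `A` forgets the dependence of the tangent spaces on the base point, so that `π x` can be
  -- replaced by `π x₀`
  let A : Y → EuclideanSpace ℝ (Fin m) → EuclideanSpace ℝ (Fin m) := fun y =>
    mfderiv (𝓡 m) (𝓡 m) (chartAt (EuclideanSpace ℝ (Fin m)) y₀) y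
  have hA : A (π x) (mfderiv (𝓡 n) (𝓡 m) π x (v x)) =
    A (π x₀) (mfderiv (𝓡 n) (𝓡 m) π x₀ (v x₀)) := hconst
  rw [hπx] at hA
  exact mfderiv_chartAt_injective (hτ x₀ hx₀).1 hA

end

/-! ### Lumpability and invariance -/

section

variable {n m : ℕ} {X Y : Type*}
  [TopologicalSpace X] [ChartedSpace (EuclideanSpace ℝ (Fin n)) X] [IsManifold (𝓡 n) ∞ X]
  [TopologicalSpace Y] [ChartedSpace (EuclideanSpace ℝ (Fin m)) Y] [IsManifold (𝓡 m) ∞ Y]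
  {π : X → Y} {v : (x : X) → TangentSpace (𝓡 n) x}

/-- Exact lumpability is the infinitesimal condition that `v` is `π`-related to a smooth vector
field on `Y`. An integral curve of `v` through each point turns the dynamical condition into the pointwise
one; the converse is the chain rule. -/
theorem exactlyLumpable_iff_exists_related (hπ : ContMDiff (𝓡 n) (𝓡 m) ∞ π)
    (hv : IsSmoothVectorField v) :
    ExactlyLumpable (m := m) v π ↔ ∃ v' : (y : Y) → TangentSpace (𝓡 m) y,
      IsSmoothVectorField v' ∧ ∀ x, mfderiv (𝓡 n) (𝓡 m) π x (v x) = v' (π x) := by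
  have hπd (x : X) : HasMFDerivAt (𝓡 n) (𝓡 m) π x (mfderiv (𝓡 n) (𝓡 m) π x) :=
    ((hπ x).mdifferentiableAt (by simp)).hasMFDerivAt
  refine exists_congr fun v' => and_congr_right fun _ =>
    ⟨fun h x => ?_, fun h γ J _ _ hγ t ht => ?_⟩
  · have : IsManifold (𝓡 n) 1 X := .of_le (n := ∞) (by simp)
    obtain ⟨γ, rfl, hγ⟩ := exists_isMIntegralCurveAt_of_contMDiffAt_boundaryless (I := 𝓡 n)
      (t₀ := 0) ((hv x).of_le (by simp))
    obtain ⟨ε, hε, hball⟩ := isMIntegralCurveAt_iff'.1 hγ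
    have h0 : Metric.ball (0 : ℝ) ε ∈ 𝓝 0 := Metric.ball_mem_nhds _ hε
    have h1 := (h γ _ Metric.isOpen_ball (convex_ball (0 : ℝ) ε).ordConnected hball 0
      (mem_of_mem_nhds h0)).hasMFDerivAt h0
    have h2 := (hπd (γ 0)).comp 0 ((hball 0 (mem_of_mem_nhds h0)).hasMFDerivAt h0)
    have h3 := DFunLike.congr_fun (hasMFDerivAt_unique h2 h1) (1 : ℝ)
    have h4 : mfderiv (𝓡 n) (𝓡 m) π (γ 0) ((1 : ℝ) • v (γ 0)) = (1 : ℝ) • v' (π (γ 0)) := h3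
    rwa [one_smul, one_smul] at h4
  · have h1 := (hπd (γ t)).comp_hasMFDerivWithinAt t (hγ t ht)
    have he : (mfderiv (𝓡 n) (𝓡 m) π (γ t)).comp ((1 : ℝ →L[ℝ] ℝ).smulRight (v (γ t))) =
        (1 : ℝ →L[ℝ] ℝ).smulRight (v' (π (γ t))) := by
      refine ContinuousLinearMap.ext fun r => ?_
      change mfderiv (𝓡 n) (𝓡 m) π (γ t) (r • v (γ t)) = r • v' (π (γ t))
      rw [map_smul, h]
    exact h1.congr_mfderiv he

/-- If `v` is `π`-related to a field on `Y`, its horizontal component is constant along the fibres,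
so the derivative that computes the horizontal component of `[v, w]` vanishes. -/
theorem ExactlyLumpable.verticalFieldsInvariant (h : ExactlyLumpable (m := m) v π)
    (hπ : ContMDiff (𝓡 n) (𝓡 m) ∞ π)
    (hsurj : ∀ x, Function.Surjective (mfderiv (𝓡 n) (𝓡 m) π x)) (hv : IsSmoothVectorField v) :
    VerticalFieldsInvariant (m := m) v π := by
  obtain ⟨v', -, hv'⟩ := (exactlyLumpable_iff_exists_related hπ hv).1 h
  intro w hw
  refine ⟨fun x => ?_, fun x => ?_⟩
  · have : IsManifold (𝓡 n) (∞ + 1) X := .of_le (n := ∞) (by simp)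
    have : IsManifold (𝓡 n) (minSmoothness ℝ 3) X :=
      .of_le (n := ∞) (by simpa using ENat.LEInfty.out)
    exact ContMDiffAt.mlieBracket_vectorField (m := ⊤) (n := ⊤) (hv x) (hw.1 x) (by simp)
  obtain ⟨K, τ, hx, hτ⟩ := hπ.exists_straightens x (hsurj x)
  refine mfderiv_chartAt_injective (hτ x hx).1 ?_
  rw [hτ.mfderiv_mlieBracket hπ hv hw hx, map_zero]
  refine (neg_eq_zero (α := EuclideanSpace ℝ (Fin m))).2 ?_
  set u : EuclideanSpace ℝ (Fin m) × K → EuclideanSpace ℝ (Fin m) := fun q =>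
    (VectorField.mpullback 𝓘(ℝ, EuclideanSpace ℝ (Fin m) × K) (𝓡 n) τ.symm v q :
      EuclideanSpace ℝ (Fin m) × K).1 with hu
  set b : EuclideanSpace ℝ (Fin m) × K :=
    mfderiv (𝓡 n) 𝓘(ℝ, EuclideanSpace ℝ (Fin m) × K) τ x (w x) with hb
  have hb1 : b.1 = 0 := by rw [hb, hτ.fst_mfderiv hπ hx, hw.2, map_zero]; rfl
  have hud : DifferentiableAt ℝ u (τ x) :=
    ((contDiffAt_mpullback_symm hv hx).differentiableAt (by simp)).fst
  -- along a fibre of `π`, the horizontal component `u` depends only on the point of `Y` below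
  have huv : ∀ z ∈ τ.source, (τ z).1 = (τ x).1 → u (τ z) = u (τ x) := by
    intro z hz hzx
    have hπz : π z = π x := by
      refine (chartAt (EuclideanSpace ℝ (Fin m)) (π x)).injOn (hτ z hz).1 (hτ x hx).1 ?_
      rw [← (hτ z hz).2, ← (hτ x hx).2, hzx]
    rw [hu]
    dsimp only
    rw [hτ.fst_mpullback_symm hπ v hz, hτ.fst_mpullback_symm hπ v hx, hv', hv', hπz]
  have hlim : Tendsto (fun t : ℝ => τ x + t • b) (𝓝 0) (𝓝 (τ x)) := by
    have : Continuous fun t : ℝ => τ x + t • b := by fun_prop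
    simpa using this.tendsto 0
  -- `b` is vertical, so it suffices to differentiate `u` along a line contained in a fibre
  have hline : HasLineDerivAt ℝ u (fderiv ℝ u (τ x) b) (τ x) b := hud.hasFDerivAt.hasLineDerivAt b
  refine hline.unique ?_
  refine HasDerivAt.congr_of_eventuallyEq (hasDerivAt_const (0 : ℝ) (u (τ x))) ?_
  filter_upwards [hlim (τ.open_target.mem_nhds (τ.map_source hx))] with t ht
  have hr : τ (τ.symm (τ x + t • b)) = τ x + t • b := τ.right_inv ht
  rw [← hr]
  exact huv _ (τ.map_target ht) (by rw [hr]; simp [hb1])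

/-- If `L_v` preserves the vertical fields and the fibres are connected, then `Dπ_x (v x)` depends
only on `π x`. -/
theorem VerticalFieldsInvariant.mfderiv_eq [T2Space X]
    (h : VerticalFieldsInvariant (m := m) v π) (hπ : ContMDiff (𝓡 n) (𝓡 m) ∞ π)
    (hsurj : ∀ x, Function.Surjective (mfderiv (𝓡 n) (𝓡 m) π x)) (hv : IsSmoothVectorField v)
    (hconn : ∀ y, IsPreconnected (π ⁻¹' {y})) {x x' : X} (hxx' : π x = π x') :
    (mfderiv (𝓡 n) (𝓡 m) π x (v x) : EuclideanSpace ℝ (Fin m)) =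
      mfderiv (𝓡 n) (𝓡 m) π x' (v x') := by
  let G : X → EuclideanSpace ℝ (Fin m) := fun x => mfderiv (𝓡 n) (𝓡 m) π x (v x)
  have hG : IsLocallyConstant fun z : π ⁻¹' {π x'} => G z := by
    refine (IsLocallyConstant.iff_eventually_eq _).2 fun z => ?_
    obtain ⟨K, τ, hz, hτ⟩ := hπ.exists_straightens z.1 (hsurj z)
    have := hτ.eventually_mfderiv_eq hπ hv
      (fun p hp c => h.fderiv_fst_mpullback_eq_zero hπ hsurj hv hτ hp c) hz
    filter_upwards [continuous_subtype_val.continuousAt.eventually this] with z' hz'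
    exact hz' (z'.2.trans z.2.symm)
  have := Subtype.preconnectedSpace (hconn (π x'))
  exact hG.apply_eq_of_preconnectedSpace ⟨x, hxx'⟩ ⟨x', rfl⟩

/-- A submersion has smooth local sections: freeze the second factor of straightened coordinates. -/
theorem exists_contMDiffAt_section (hπ : ContMDiff (𝓡 n) (𝓡 m) ∞ π) (x : X)
    (hsurj : Function.Surjective (mfderiv (𝓡 n) (𝓡 m) π x)) :
    ∃ s : Y → X, ContMDiffAt (𝓡 m) (𝓡 n) ∞ s (π x) ∧ ∀ᶠ y in 𝓝 (π x), π (s y) = y := by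
  obtain ⟨K, τ, hx, hτ⟩ := hπ.exists_straightens x hsurj
  set c := chartAt (EuclideanSpace ℝ (Fin m)) (π x) with hc
  have hsx : (c (π x), (τ x).2) = τ x := by rw [hc, ← (hτ x hx).2]
  have hι : ContMDiffAt (𝓡 m) 𝓘(ℝ, EuclideanSpace ℝ (Fin m) × K) ∞
      (fun y => (c y, (τ x).2)) (π x) := by
    have hcx : ContMDiffAt (𝓡 m) (𝓡 m) ∞ c (π x) :=
      contMDiffOn_chart.contMDiffAt (chart_source_mem_nhds (EuclideanSpace ℝ (Fin m)) (π x))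
    exact hcx.prodMk_space contMDiffAt_const
  refine ⟨fun y => τ.symm (c y, (τ x).2), ContMDiffAt.comp (π x) ?_ hι, ?_⟩
  · rw [hsx]
    exact τ.symm.contMDiffAt (τ.map_source hx)
  · have h1 : τ.target ∈ 𝓝 (c (π x), (τ x).2) := by
      rw [hsx]; exact τ.open_target.mem_nhds (τ.map_source hx)
    filter_upwards [hι.continuousAt.preimage_mem_nhds h1,
      chart_source_mem_nhds (EuclideanSpace ℝ (Fin m)) (π x)] with y hy hyc
    have hz : τ.symm (c y, (τ x).2) ∈ τ.source := τ.map_target hy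
    refine c.injOn (hτ _ hz).1 hyc ?_
    rw [hc, ← (hτ _ hz).2, ← hc]
    exact congrArg Prod.fst (τ.right_inv hy)

/-- With connected fibres, invariance of the vertical fields makes `Dπ (v)` descend to `Y`. Its value
at `y` is computed at an arbitrary point of the fibre; smoothness comes from local sections. -/
theorem VerticalFieldsInvariant.exactlyLumpable [T2Space X]
    (h : VerticalFieldsInvariant (m := m) v π)
    (hπ : IsSmoothSurjectiveSubmersion (n := n) (m := m) π)
    (hv : IsSmoothVectorField v) (hconn : ∀ y, IsPreconnected (π ⁻¹' {y})) :
    ExactlyLumpable (m := m) v π := by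
  rw [exactlyLumpable_iff_exists_related hπ.smooth hv]
  let v' : (y : Y) → TangentSpace (𝓡 m) y := fun y =>
    (mfderiv (𝓡 n) (𝓡 m) π (Function.surjInv hπ.surjective y)
      (v (Function.surjInv hπ.surjective y)) : EuclideanSpace ℝ (Fin m))
  have hv' : ∀ x, mfderiv (𝓡 n) (𝓡 m) π x (v x) = v' (π x) := fun x =>
    h.mfderiv_eq hπ.smooth hπ.submersive hv hconn (Function.surjInv_eq hπ.surjective (π x)).symm
  refine ⟨v', fun y => ?_, hv'⟩
  obtain ⟨x, rfl⟩ := hπ.surjective y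
  obtain ⟨s, hs, hsπ⟩ := exists_contMDiffAt_section hπ.smooth x (hπ.submersive x)
  have hT : ContMDiff (𝓡 n).tangent (𝓡 m).tangent ∞ (tangentMap (𝓡 n) (𝓡 m) π) :=
    hπ.smooth.contMDiff_tangentMap (by simp)
  -- `v' ∘ π` is `Tπ ∘ v`, so near `π x` the section `v'` is `Tπ ∘ v ∘ s`
  refine (((hT.comp hv).contMDiffAt (x := s (π x))).comp (π x) hs).congr_of_eventuallyEq ?_
  filter_upwards [hsπ] with y hy
  change _ = (⟨π (s y), mfderiv (𝓡 n) (𝓡 m) π (s y) (v (s y))⟩ : TangentBundle (𝓡 m) Y)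
  rw [hv', hy]

end

end

theorem mainTheorem1 {n m : ℕ} {X Y : Type*}
    [TopologicalSpace X] [T2Space X] [SecondCountableTopology X]
    [ChartedSpace (EuclideanSpace ℝ (Fin n)) X] [IsManifold (𝓡 n) ∞ X]
    [TopologicalSpace Y] [T2Space Y] [SecondCountableTopology Y]
    [ChartedSpace (EuclideanSpace ℝ (Fin m)) Y] [IsManifold (𝓡 m) ∞ Y]
    (π : X → Y) (hπ : IsSmoothSurjectiveSubmersion (n := n) (m := m) π)
    (v : (x : X) → TangentSpace (𝓡 n) x) (hv : IsSmoothVectorField v) :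
    (ExactlyLumpable (m := m) v π → VerticalFieldsInvariant (m := m) v π) ∧
    ((∀ y : Y, IsConnected (π ⁻¹' {y})) →
      (ExactlyLumpable (m := m) v π ↔ VerticalFieldsInvariant (m := m) v π)) :=
  have h (h' : ExactlyLumpable (m := m) v π) : VerticalFieldsInvariant (m := m) v π :=
    h'.verticalFieldsInvariant hπ.smooth hπ.submersive hv
  ⟨h, fun hconn => ⟨h, fun h' => h'.exactlyLumpable hπ hv fun y => (hconn y).isPreconnected⟩⟩
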